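/- Let $k\ge 1$ be an odd integer and let $\xi(s)=\tfrac12 s(s-1)\pi^{-s/2}\Gamma(s/2)\zeta(s)$ be the Riemann xi function, regarded as an entire function. Let $\rho=\beta+i\gamma$ run over the nontrivial zeros of the Riemann zeta function $\zeta(s)$ (its zeros with $0<\beta<1$), counted with multiplicity. The series $\sum_\rho |1/2-\rho|^{-(k+1)}$ converges, and the following hold. (1) If the Riemann Hypothesis holds, then $$\frac{(-1)^{(k-1)/2}}{k!}\left(\frac{\xi'}{\xi}\right)^{(k)}\!\left(\frac12\right)=\sum_{\rho}\frac{1}{|1/2-\rho|^{k+1}}.\qquad(*)$$ (2) Conversely, suppose that $(*)$ holds. If $k\ge 3$, then every nontrivial zero $\rho=\beta+i\gamma$ with $|\gamma|>\tfrac12\cot\left(\frac{2\pi}{k+1}\right)$ satisfies $\beta=\tfrac12$. If $k=1$ (where $\cot\pi$ is undefined), then every nontrivial zero satisfies $\beta=\tfrac12$. -/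

import Mathlib

/-- The Riemann xi function
`ξ(s) = (1/2) s (s - 1) π^(-s/2) Γ(s/2) ζ(s)`, as an entire function. Mathlib's entire function
`completedRiemannZeta₀ s` is `π^(-s/2) Γ(s/2) ζ(s) + 1/s + 1/(1-s)`, so that multiplying by
`s (s - 1)` and adding `1` removes the singularities; see `riemannXi_eq` for the usual formula. -/
noncomputable def riemannXi (s : ℂ) : ℂ :=
  (s * (s - 1) * completedRiemannZeta₀ s + 1) / 2

/-- `riemannXi` is given by the usual formula wherever the latter makes sense literally,
that is, away from `s = 1` and from the poles `0, -2, -4, …` of `Γ(s/2)`. -/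
theorem riemannXi_eq (s : ℂ) (h1 : s ≠ 1) (hΓ : ∀ n : ℕ, s ≠ -(2 * (n : ℂ))) :
    riemannXi s = 1 / 2 * s * (s - 1) * (Real.pi : ℂ) ^ (-s / 2) * Complex.Gamma (s / 2) *
      riemannZeta s := by
  have h0 : s ≠ 0 := by simpa using hΓ 0
  have hG : Complex.Gammaℝ s ≠ 0 := by
    rw [Ne, Complex.Gammaℝ_eq_zero_iff]
    rintro ⟨n, hn⟩
    exact hΓ n hn
  have h1' : 1 - s ≠ 0 := sub_ne_zero.mpr (Ne.symm h1)
  have key : (Real.pi : ℂ) ^ (-s / 2) * Complex.Gamma (s / 2) * riemannZeta s =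
      completedRiemannZeta s := by
    rw [← Complex.Gammaℝ_def, riemannZeta_def_of_ne_zero h0]
    field_simp
  have : 1 / 2 * s * (s - 1) * (Real.pi : ℂ) ^ (-s / 2) * Complex.Gamma (s / 2) * riemannZeta s =
      1 / 2 * s * (s - 1) * completedRiemannZeta s := by
    rw [← key]; ring
  rw [this, completedRiemannZeta_eq, riemannXi]
  field_simp
  ring

/-- `riemannXi` is entire. -/
theorem differentiable_riemannXi : Differentiable ℂ riemannXi := by
  unfold riemannXi
  have := differentiable_completedZeta₀
  fun_prop

/-- The nontrivial zeros of the Riemann zeta function: its zeros in the open critical strip. -/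
def zetaNontrivialZeros : Set ℂ :=
  {ρ : ℂ | riemannZeta ρ = 0 ∧ 0 < ρ.re ∧ ρ.re < 1}

/-- The term `1 / |1/2 - ρ|^(k+1)` of the sum over nontrivial zeros, repeated according to the
multiplicity of the zero `ρ` of `ζ`. -/
noncomputable def zetaZeroTerm (k : ℕ) (ρ : zetaNontrivialZeros) : ℝ :=
  (analyticOrderNatAt riemannZeta (ρ : ℂ) : ℝ) * (1 / ‖1 / 2 - (ρ : ℂ)‖ ^ (k + 1))

/-!
The function `f z = ξ (1/2 + z)` is entire, `f 0 ≠ 0`, and its zeros `a = ρ - 1/2` correspond to the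
nontrivial zeros of `ζ`, with the same multiplicities `m a`. The heart of the proof is the identity
`(f'/f)^(k) (0) = -k! ∑ m a / a ^ (k + 1)` for `k ≥ 1` (`hasSum_iteratedDeriv_logDeriv`). For odd
`k` it says that the left-hand side of the equality in question is `∑ m a / (I a) ^ (k + 1)`.

Under the Riemann Hypothesis every `I a` is real, and since `k + 1` is even, each term equals
`m a / |a| ^ (k + 1)`. Conversely, the real part of each term is at most `m a / |a| ^ (k + 1)`, so
equality of the sums forces equality of all the terms: every `(I a) ^ (k + 1)` is a positive real
number. Hence the angle between `I a` and the real axis is a multiple of `2π / (k + 1)`. If `I a` is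
not real, then this angle is at least `2π / (k + 1)`, so that
`|Re (I a)| ≤ |Im (I a)| cot (2π / (k + 1))` with `|Im (I a)| < 1/2`
(`four_le_and_abs_re_mul_sin_le`).

The identity is obtained without the Hadamard product, for any entire `f` with `f 0 ≠ 0` and
`|f z| ≤ exp (C R ^ (3/2))` on `|z| ≤ R`. Write `f = P g` with `P` the product of the factors
`(1 - z / a) ^ m a` over the zeros with `|a| ≤ R`. On `|z| = 3R` all these factors have modulus at
least `2`, so the maximum principle bounds both the number of zeros with `|a| ≤ R` by
`O(R ^ (3/2))` (`exists_sum_order_le`), which gives absolute convergence by a dyadic decomposition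
(`summable_order_div_norm_pow`), and `|g|` on `|z| ≤ R`. As `g` does not vanish there, it has a
logarithm; by Borel-Carathéodory and Cauchy's estimate, `(g'/g)^(k) (0) = O(R ^ (3/2 - (k + 1)))`
(`norm_iteratedDeriv_logDeriv_le`), which tends to `0`.

The growth of `ξ` follows from that of the entire function `Λ₀`, the Mellin transform of a modified
theta function, which decays exponentially (`norm_completedRiemannZeta₀_le`). The same estimate
gives `|Λ₀ (1/2)| < 4`, that is, `ξ (1/2) ≠ 0`.
-/

open Complex Set MeasureTheory Filter Topology HurwitzZeta

/-! ### Growth of the xi function -/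

lemma abs_evenKernel_zero_sub_one_le {x : ℝ} (hx : 1 ≤ x) :
    |evenKernel 0 x - 1| ≤ 4 * Real.exp (-(3 * x)) := by
  have h0 : 0 < x := by linarith
  have hval : ((evenKernel 0 x : ℝ) : ℂ) = jacobiTheta (I * x) := by
    rw [evenKernel_eq_cosKernel_of_zero, ← QuotientAddGroup.mk_zero, jacobiTheta_eq_jacobiTheta₂]
    simpa using cosKernel_def 0 x
  have him : 0 < (I * x).im := by simpa using h0
  have h := norm_jacobiTheta_sub_one_le him
  rw [← hval, ← ofReal_one, ← ofReal_sub, norm_real, Real.norm_eq_abs] at h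
  have himx : (I * x).im = x := by simp
  rw [himx] at h
  have hpi := Real.pi_gt_three
  have he : Real.exp (-Real.pi * x) ≤ Real.exp (-(3 * x)) := Real.exp_le_exp.2 (by nlinarith)
  have hhalf : Real.exp (-(3 * x)) ≤ 1 / 2 := by
    rw [Real.exp_neg, inv_le_comm₀ (Real.exp_pos _) (by norm_num)]
    linarith [Real.add_one_le_exp (3 * x)]
  refine h.trans (mul_le_mul ?_ he (Real.exp_pos _).le (by norm_num))
  rw [div_le_iff₀ (by linarith)]
  linarith

/-- An integrable majorant of the integrand of the Mellin transform defining `Λ₀`. On `(0, 1)` the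
functional equation of the theta function turns the decay at infinity into the bound `1`. -/
lemma norm_cpow_smul_f_modif_le {s : ℂ} {n : ℕ} (hs : 1 / 4 ≤ s.re) (hn : s.re - 1 ≤ n) {x : ℝ}
    (hx : 0 < x) : ‖(x : ℂ) ^ (s - 1) • (hurwitzEvenFEPair 0).f_modif x‖ ≤
      (Ioo 0 1).indicator (fun _ ↦ (1 : ℝ)) x +
        4 * (Real.exp (-x) * x ^ ((n + 1 : ℝ) - 1)) := by
  have hpos : 0 ≤ 4 * (Real.exp (-x) * x ^ ((n + 1 : ℝ) - 1)) := by positivity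
  rw [norm_smul, norm_cpow_eq_rpow_re_of_pos hx, sub_re, one_re, WeakFEPair.f_modif, Pi.add_apply]
  rcases lt_trichotomy x 1 with h1 | rfl | h1
  · rw [indicator_of_notMem (by simp [h1.le]), indicator_of_mem (mem_Ioo.2 ⟨hx, h1⟩),
      indicator_of_mem (mem_Ioo.2 ⟨hx, h1⟩), zero_add]
    refine le_add_of_le_of_nonneg ?_ hpos
    have hx1 : 1 ≤ 1 / x := by rw [le_div_iff₀ hx]; linarith
    have hval : (hurwitzEvenFEPair 0).f x - ((hurwitzEvenFEPair 0).ε *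
        ((x ^ (-(hurwitzEvenFEPair 0).k) : ℝ) : ℂ)) • (hurwitzEvenFEPair 0).g₀ =
        ((x ^ (-(1 / 2) : ℝ) * (evenKernel 0 (1 / x) - 1) : ℝ) : ℂ) := by
      simp only [hurwitzEvenFEPair, Function.comp_apply, one_mul, smul_eq_mul, mul_one]
      rw [evenKernel_functional_equation, ← evenKernel_eq_cosKernel_of_zero,
        Real.rpow_neg hx.le]
      push_cast
      ring
    rw [hval, norm_real, Real.norm_eq_abs, abs_mul, abs_of_pos (Real.rpow_pos_of_pos hx _)]
    have hA : x ^ (s.re - 1) ≤ 1 / x := by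
      rw [one_div x, ← Real.rpow_neg_one]
      exact Real.rpow_le_rpow_of_exponent_ge hx h1.le (by linarith)
    have hB : x ^ (-(1 / 2) : ℝ) ≤ 1 / x := by
      rw [one_div x, ← Real.rpow_neg_one]
      exact Real.rpow_le_rpow_of_exponent_ge hx h1.le
        (by norm_num : (-1 : ℝ) ≤ -(1 / 2))
    have hC := abs_evenKernel_zero_sub_one_le hx1
    set t := 1 / x
    have hE : 2 * t ≤ Real.exp t := by
      nlinarith [Real.quadratic_le_exp_of_nonneg (by linarith : 0 ≤ t), sq_nonneg (t - 1)]
    have hD : Real.exp (-(3 * t)) ≤ ((2 * t) ^ 2)⁻¹ := by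
      rw [Real.exp_neg]
      gcongr
      calc (2 * t) ^ 2 ≤ Real.exp t ^ 2 := by gcongr
        _ = Real.exp (2 * t) := by rw [← Real.exp_nat_mul]; norm_num
        _ ≤ _ := Real.exp_le_exp.2 (by linarith)
    calc x ^ (s.re - 1) * (x ^ (-(1 / 2) : ℝ) * |evenKernel 0 t - 1|)
        ≤ t * (t * (4 * ((2 * t) ^ 2)⁻¹)) := by
          gcongr
          exact hC.trans (by gcongr)
      _ = 1 := by field_simp; norm_num
  · simpa using hpos
  · rw [indicator_of_mem (mem_Ioi.2 h1), indicator_of_notMem (by simp [h1.le]),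
      indicator_of_notMem (by simp [h1.le]), zero_add, add_zero]
    have hval : (hurwitzEvenFEPair 0).f x - (hurwitzEvenFEPair 0).f₀ =
        ((evenKernel 0 x - 1 : ℝ) : ℂ) := by
      simp [hurwitzEvenFEPair]
    rw [hval, norm_real, Real.norm_eq_abs]
    have hA : x ^ (s.re - 1) ≤ x ^ ((n + 1 : ℝ) - 1) :=
      Real.rpow_le_rpow_of_exponent_le h1.le (by linarith)
    have hC := abs_evenKernel_zero_sub_one_le h1.le
    have hD : Real.exp (-(3 * x)) ≤ Real.exp (-x) := Real.exp_le_exp.2 (by linarith)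
    calc x ^ (s.re - 1) * |evenKernel 0 x - 1|
        ≤ x ^ ((n + 1 : ℝ) - 1) * (4 * Real.exp (-x)) := by
          gcongr
          exact hC.trans (by gcongr)
      _ = _ := by ring

/-- At `s = 1/2`, `n = 0` the bound is `5/2 < 4`, which shows `ξ (1/2) ≠ 0`; for large `n` it shows
that `ξ` has order at most one. -/
lemma norm_completedRiemannZeta₀_le {s : ℂ} {n : ℕ} (hs : 1 / 2 ≤ s.re) (hn : s.re / 2 - 1 ≤ n) :
    ‖completedRiemannZeta₀ s‖ ≤ (1 + 4 * n.factorial) / 2 := by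
  have hre : (s / 2).re = s.re / 2 := by simp
  have key : ‖(hurwitzEvenFEPair 0).Λ₀ (s / 2)‖ ≤ 1 + 4 * n.factorial := by
    have hi1 : IntegrableOn ((Ioo 0 1).indicator fun _ ↦ (1 : ℝ)) (Ioi (0 : ℝ)) := by
      refine Integrable.integrableOn ?_
      rw [integrable_indicator_iff measurableSet_Ioo]
      exact integrableOn_const (by simp)
    have hi2 : IntegrableOn (fun x : ℝ ↦ 4 * (Real.exp (-x) * x ^ ((n + 1 : ℝ) - 1)))
        (Ioi 0) := (Real.GammaIntegral_convergent (by positivity)).const_mul 4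
    have hint : ∫ x in Ioi (0 : ℝ), ((Ioo 0 1).indicator (fun _ ↦ (1 : ℝ)) x +
        4 * (Real.exp (-x) * x ^ ((n + 1 : ℝ) - 1))) = 1 + 4 * n.factorial := by
      rw [integral_add hi1 hi2, integral_const_mul, ← Real.Gamma_eq_integral (by positivity),
        Real.Gamma_nat_eq_factorial, setIntegral_indicator measurableSet_Ioo,
        inter_eq_self_of_subset_right Ioo_subset_Ioi_self]
      simp
    rw [WeakFEPair.Λ₀, mellin, ← hint]
    refine norm_integral_le_of_norm_le (hi1.add hi2) ?_
    filter_upwards [ae_restrict_mem measurableSet_Ioi] with x hx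
    exact norm_cpow_smul_f_modif_le (by rw [hre]; linarith) (by rw [hre]; linarith) hx
  rw [completedRiemannZeta₀, completedHurwitzZetaEven₀, norm_div, RCLike.norm_ofNat]
  gcongr

lemma riemannXi_one_half_ne_zero : riemannXi (1 / 2) ≠ 0 := by
  intro h
  have h1 : completedRiemannZeta₀ (1 / 2) = 4 := by
    rw [riemannXi] at h
    linear_combination -8 * h
  have h2 := norm_completedRiemannZeta₀_le (s := 1 / 2) (n := 0) (by norm_num) (by norm_num)
  rw [h1] at h2
  norm_num at h2

lemma riemannXi_one_sub (s : ℂ) : riemannXi (1 - s) = riemannXi s := by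
  rw [riemannXi, riemannXi, completedRiemannZeta₀_one_sub]
  ring

lemma le_exp_two_mul_sqrt {x : ℝ} (hx : 0 ≤ x) : x ≤ Real.exp (2 * √x) := by
  have h : √x ≤ Real.exp √x := by linarith [Real.add_one_le_exp √x]
  calc x = √x ^ 2 := (Real.sq_sqrt hx).symm
    _ ≤ Real.exp √x ^ 2 := by gcongr
    _ = _ := by rw [← Real.exp_nat_mul]; norm_num

/-- The growth of `ξ` around its centre of symmetry. The true order of magnitude is
`exp (O(R log R))`; the cruder exponent `R ^ (3/2)` is enough, being `o(R ^ 2)`. -/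
lemma norm_riemannXi_le {R : ℝ} (hR : 1 ≤ R) {z : ℂ} (hz : ‖z‖ ≤ R) :
    ‖riemannXi (1 / 2 + z)‖ ≤ Real.exp (16 * (R * √R)) := by
  -- By the functional equation it suffices to treat `Re (1/2 + z) ≥ 1/2`.
  wlog hre : 0 ≤ z.re generalizing z
  · have := this (z := -z) (by simpa using hz) (by simp; linarith)
    rwa [← riemannXi_one_sub, show 1 - (1 / 2 + -z) = 1 / 2 + z by ring] at this
  have hzre : z.re ≤ R := (re_le_norm z).trans hz
  set n := ⌈R⌉₊ with hn
  have hRn : R ≤ n := Nat.le_ceil R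
  have hn2 : (n : ℝ) ≤ 2 * R := by linarith [Nat.ceil_lt_add_one (by linarith : 0 ≤ R)]
  have hL := norm_completedRiemannZeta₀_le (s := 1 / 2 + z) (n := n)
    (by simp; linarith) (by simp; linarith)
  have hfac : (1 : ℝ) ≤ n.factorial := by
    exact_mod_cast Nat.one_le_iff_ne_zero.2 n.factorial_ne_zero
  have hpoly : ‖(1 / 2 + z) * (1 / 2 + z - 1)‖ ≤ 2 * R ^ 2 := by
    rw [show (1 / 2 + z) * (1 / 2 + z - 1) = z ^ 2 - 1 / 4 by ring]
    refine (norm_sub_le _ _).trans ?_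
    rw [norm_pow]
    have : ‖z‖ ^ 2 ≤ R ^ 2 := by gcongr
    norm_num
    nlinarith
  have h1 : ‖riemannXi (1 / 2 + z)‖ ≤ 4 * R ^ 2 * n.factorial := by
    rw [riemannXi, norm_div, RCLike.norm_ofNat, div_le_iff₀ two_pos]
    refine (norm_add_le _ _).trans ?_
    rw [norm_mul, norm_one]
    have : ‖(1 / 2 + z) * (1 / 2 + z - 1)‖ * ‖completedRiemannZeta₀ (1 / 2 + z)‖ ≤
        2 * R ^ 2 * ((1 + 4 * n.factorial) / 2) := by gcongr
    nlinarith [mul_le_mul hR hR (by norm_num) (by linarith),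
      mul_le_mul_of_nonneg_left hfac (sq_nonneg R)]
  have hsq : 1 ≤ √R := Real.one_le_sqrt.2 hR
  have hsR : √(2 * R) ≤ 2 * √R := by
    rw [Real.sqrt_mul (by norm_num)]
    gcongr
    exact Real.sqrt_le_iff.2 (by norm_num)
  have h2R : 2 * R ≤ Real.exp (4 * √R) :=
    (le_exp_two_mul_sqrt (by linarith)).trans (Real.exp_le_exp.2 (by linarith))
  have h2 : (n.factorial : ℝ) ≤ Real.exp (8 * (R * √R)) :=
    calc (n.factorial : ℝ) ≤ (n : ℝ) ^ n := by exact_mod_cast n.factorial_le_pow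
      _ ≤ Real.exp (4 * √R) ^ n := by gcongr; exact hn2.trans h2R
      _ = Real.exp (n * (4 * √R)) := by rw [Real.exp_nat_mul]
      _ ≤ _ := Real.exp_le_exp.2 (by nlinarith)
  calc ‖riemannXi (1 / 2 + z)‖ ≤ (2 * R) ^ 2 * n.factorial := by rw [mul_pow]; norm_num; exact h1
    _ ≤ Real.exp (4 * √R) ^ 2 * Real.exp (8 * (R * √R)) := by gcongr
    _ = Real.exp (8 * √R + 8 * (R * √R)) := by
      rw [← Real.exp_nat_mul, ← Real.exp_add]; norm_num; ring
    _ ≤ _ := Real.exp_le_exp.2 (by nlinarith)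

/-! ### Factoring out the zeros of an entire function -/

/-- The full power of `z - a` dividing an entire function can be split off globally. -/
lemma Differentiable.exists_eq_pow_mul {f : ℂ → ℂ} (hf : Differentiable ℂ f) {a : ℂ}
    (ha : analyticOrderAt f a ≠ ⊤) :
    ∃ g : ℂ → ℂ, Differentiable ℂ g ∧ g a ≠ 0 ∧
      ∀ z, f z = (z - a) ^ analyticOrderNatAt f a * g z := by
  obtain ⟨h, hh, hha, hfh⟩ := (hf.analyticAt a).analyticOrderAt_ne_top.1 ha
  set m := analyticOrderNatAt f a
  -- The quotient extends over `a` by the value of the local cofactor `h`.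
  have hloc : Function.update (fun z ↦ f z / (z - a) ^ m) a (h a) =ᶠ[𝓝 a] h := by
    filter_upwards [hfh] with z hz
    rcases eq_or_ne z a with rfl | hza
    · simp
    · have : (z - a) ^ m ≠ 0 := pow_ne_zero _ (sub_ne_zero.2 hza)
      rw [Function.update_of_ne hza, hz, smul_eq_mul]
      field_simp
  refine ⟨Function.update (fun z ↦ f z / (z - a) ^ m) a (h a), fun z ↦ ?_, by simpa, fun z ↦ ?_⟩
  · rcases eq_or_ne z a with rfl | hza
    · exact hh.differentiableAt.congr_of_eventuallyEq hloc
    · have h1 : DifferentiableAt ℂ (fun z ↦ f z / (z - a) ^ m) z :=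
        (hf z).div (by fun_prop) (pow_ne_zero _ (sub_ne_zero.2 hza))
      refine h1.congr_of_eventuallyEq ?_
      filter_upwards [isOpen_ne.mem_nhds hza] with w hw
      exact Function.update_of_ne hw _ _
  · rcases eq_or_ne z a with rfl | hza
    · simpa using hfh.self_of_nhds
    · have : (z - a) ^ m ≠ 0 := pow_ne_zero _ (sub_ne_zero.2 hza)
      rw [Function.update_of_ne hza]
      field_simp

lemma Differentiable.analyticOrderAt_ne_top {f : ℂ → ℂ} (hf : Differentiable ℂ f) (h0 : f 0 ≠ 0)
    (a : ℂ) : analyticOrderAt f a ≠ ⊤ := by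
  intro h
  rw [analyticOrderAt_eq_top] at h
  have han : AnalyticOnNhd ℂ f univ := fun z _ ↦ hf.analyticAt z
  exact h0 (han.eqOn_zero_of_preconnected_of_eventuallyEq_zero isPreconnected_univ
    (mem_univ a) h (mem_univ 0))

/-- The product of the factors `1 - z / a` over `a ∈ S`, each raised to the order of vanishing of
`f` at `a`. The points of `S` are meant to be nonzero. -/
noncomputable def zeroProduct (f : ℂ → ℂ) (S : Finset ℂ) (z : ℂ) : ℂ :=
  ∏ a ∈ S, (1 - z / a) ^ analyticOrderNatAt f a

lemma differentiable_zeroProduct (f : ℂ → ℂ) (S : Finset ℂ) :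
    Differentiable ℂ (zeroProduct f S) := by
  unfold zeroProduct
  fun_prop

lemma zeroProduct_ne_zero (f : ℂ → ℂ) {S : Finset ℂ} (hS : 0 ∉ S) {z : ℂ} (hz : z ∉ S) :
    zeroProduct f S z ≠ 0 := by
  refine Finset.prod_ne_zero_iff.2 fun a ha ↦ pow_ne_zero _ fun h ↦ hz ?_
  have ha0 : a ≠ 0 := fun h ↦ hS (h ▸ ha)
  rw [sub_eq_zero, eq_comm, div_eq_one_iff_eq ha0] at h
  exact h ▸ ha

@[simp] lemma zeroProduct_zero (f : ℂ → ℂ) (S : Finset ℂ) : zeroProduct f S 0 = 1 := by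
  simp [zeroProduct]

lemma Differentiable.exists_eq_zeroProduct_mul {f : ℂ → ℂ} (hf : Differentiable ℂ f)
    (h0 : f 0 ≠ 0) (S : Finset ℂ) (hS : 0 ∉ S) :
    ∃ g : ℂ → ℂ, Differentiable ℂ g ∧ (∀ a ∈ S, g a ≠ 0) ∧
      ∀ z, f z = zeroProduct f S z * g z := by
  classical
  induction S using Finset.induction_on with
  | empty => exact ⟨f, hf, by simp, by simp [zeroProduct]⟩
  | insert b S hb ih =>
    have hS0 : 0 ∉ S := fun h ↦ hS (Finset.mem_insert_of_mem h)
    have hb0 : b ≠ 0 := fun h ↦ hS (h ▸ Finset.mem_insert_self _ _)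
    obtain ⟨g, hg, hgS, hfg⟩ := ih hS0
    have hord : analyticOrderAt g b = analyticOrderAt f b := by
      have hP := (differentiable_zeroProduct f S).analyticAt b
      rw [funext hfg]
      change _ = analyticOrderAt (zeroProduct f S * g) b
      rw [analyticOrderAt_mul hP (hg.analyticAt b),
        hP.analyticOrderAt_eq_zero.2 (zeroProduct_ne_zero f hS0 hb), zero_add]
    obtain ⟨h, hh, hhb, hgh⟩ := hg.exists_eq_pow_mul (a := b)
      (hord ▸ hf.analyticOrderAt_ne_top h0 b)
    have hnat : analyticOrderNatAt g b = analyticOrderNatAt f b := by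
      rw [analyticOrderNatAt, hord, analyticOrderNatAt]
    rw [hnat] at hgh
    set m := analyticOrderNatAt f b
    refine ⟨fun z ↦ (-b) ^ m * h z, by fun_prop, fun a ha ↦ ?_, fun z ↦ ?_⟩
    · refine mul_ne_zero (pow_ne_zero _ (neg_ne_zero.2 hb0)) ?_
      rcases Finset.mem_insert.1 ha with rfl | ha
      · exact hhb
      · intro h0
        exact hgS a ha (by rw [hgh, h0, mul_zero])
    · have h1 : (1 - z / b) ^ m * (-b) ^ m = (z - b) ^ m := by
        rw [← mul_pow]; congr 1; field_simp; ring
      rw [hfg, hgh, zeroProduct, zeroProduct, Finset.prod_insert hb, ← h1]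
      ring

/-- A form of Jensen's inequality: on `‖z‖ = 3R` each factor `1 - z / a` has modulus at least `2`,
so the bound follows from the maximum principle for `g`. -/
lemma norm_mul_two_pow_sum_order_le {f g : ℂ → ℂ} {S : Finset ℂ} {R B : ℝ} (hR : 0 < R)
    (hg : Differentiable ℂ g) (hfg : ∀ z, f z = zeroProduct f S z * g z) (hS : 0 ∉ S)
    (hSR : ∀ a ∈ S, ‖a‖ ≤ R) (hB : ∀ z, ‖z‖ ≤ 3 * R → ‖f z‖ ≤ B) {z : ℂ} (hz : ‖z‖ ≤ 3 * R) :
    ‖g z‖ * 2 ^ (∑ a ∈ S, analyticOrderNatAt f a) ≤ B := by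
  rw [← le_div_iff₀ (by positivity)]
  refine norm_le_of_forall_mem_frontier_norm_le (U := Metric.ball 0 (3 * R))
    Metric.isBounded_ball hg.diffContOnCl ?_ ?_
  · intro w hw
    rw [frontier_ball _ (by positivity), mem_sphere_zero_iff_norm] at hw
    rw [le_div_iff₀ (by positivity)]
    calc ‖g w‖ * 2 ^ (∑ a ∈ S, analyticOrderNatAt f a)
        ≤ ‖g w‖ * ‖zeroProduct f S w‖ := by
          gcongr
          rw [zeroProduct, norm_prod, ← Finset.prod_pow_eq_pow_sum]
          refine Finset.prod_le_prod (fun _ _ ↦ by positivity) fun a ha ↦ ?_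
          have ha0 : a ≠ 0 := fun h ↦ hS (h ▸ ha)
          have ha' : 0 < ‖a‖ := norm_pos_iff.2 ha0
          rw [norm_pow]
          gcongr
          have h3 : 3 ≤ ‖w / a‖ := by
            rw [norm_div, hw, le_div_iff₀ ha']
            linarith [hSR a ha]
          have := norm_sub_norm_le (w / a) 1
          rw [norm_one, norm_sub_rev] at this
          linarith
      _ = ‖f w‖ := by rw [hfg w, norm_mul, mul_comm]
      _ ≤ B := hB w hw.le
  · rw [closure_ball _ (by positivity)]
    simpa using hz

/-- The number of zeros in the disc of radius `R`, with multiplicity, is `O(R ^ (3/2))`. -/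
lemma exists_sum_order_le {f : ℂ → ℂ} (hf : Differentiable ℂ f) (h0 : f 0 ≠ 0) {C : ℝ}
    (hC : ∀ R : ℝ, 1 ≤ R → ∀ z, ‖z‖ ≤ R → ‖f z‖ ≤ Real.exp (C * (R * √R))) :
    ∃ K : ℝ, 0 ≤ K ∧ ∀ R : ℝ, 1 ≤ R → ∀ S : Finset ℂ, 0 ∉ S → (∀ a ∈ S, ‖a‖ ≤ R) →
      ((∑ a ∈ S, analyticOrderNatAt f a : ℕ) : ℝ) ≤ K * (R * √R) := by
  refine ⟨2 * (|C| * (3 * √3) + |Real.log ‖f 0‖|), by positivity, fun R hR S hS hSR ↦ ?_⟩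
  obtain ⟨g, hg, -, hfg⟩ := hf.exists_eq_zeroProduct_mul h0 S hS
  have h := norm_mul_two_pow_sum_order_le (by linarith) hg hfg hS hSR
    (hC (3 * R) (by linarith)) (z := 0) (by rw [norm_zero]; linarith)
  have hf0 : ‖g 0‖ = ‖f 0‖ := by simp [hfg 0]
  set N := ∑ a ∈ S, analyticOrderNatAt f a
  have hpos : 0 < ‖f 0‖ := norm_pos_iff.2 h0
  rw [hf0] at h
  have h2 := Real.log_le_log (by positivity) h
  rw [Real.log_exp, Real.log_mul hpos.ne' (by positivity), Real.log_pow] at h2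
  have hl2 : (1 : ℝ) / 2 ≤ Real.log 2 := by linarith [Real.log_two_gt_d9]
  have hN : (N : ℝ) / 2 ≤ N * Real.log 2 := by
    have : (0 : ℝ) ≤ N := Nat.cast_nonneg _
    nlinarith
  have hRR : 1 ≤ R * √R := by
    nlinarith [Real.one_le_sqrt.2 hR]
  have e1 : C * (3 * R * √(3 * R)) = C * (3 * √3) * (R * √R) := by
    rw [Real.sqrt_mul (by norm_num)]; ring
  have e2 : C * (3 * √3) * (R * √R) ≤ |C| * (3 * √3) * (R * √R) := by
    gcongr; exact le_abs_self C
  have e3 : -Real.log ‖f 0‖ ≤ |Real.log ‖f 0‖| * (R * √R) :=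
    (neg_le_abs _).trans (le_mul_of_one_le_right (abs_nonneg _) hRR)
  rw [e1] at h2
  linarith

/-- Bound for the terms of a dyadic block: for `j ≥ 1` use `x > 2 ^ (j - 1)`, for `j = 0` use
`x ≥ δ`. -/
lemma one_div_pow_le_of_two_pow_lt {x : ℝ} (j : ℕ) (hj : j = 0 ∨ (2 : ℝ) ^ (j - 1) < x)
    {p : ℕ} (hp : 2 ≤ p) (δ : ℝ) (hδ : 0 < δ) (hx : δ ≤ x) :
    1 / x ^ p ≤ (4 + 1 / δ ^ p) * (1 / 4) ^ j := by
  have hx0 : 0 < x := hδ.trans_le hx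
  rcases j with _ | i
  · have : 1 / x ^ p ≤ 1 / δ ^ p := by gcongr
    simp only [pow_zero, mul_one]
    linarith
  · replace hj : (2 : ℝ) ^ i < x := by simpa using hj
    have hx1 : 1 ≤ x := (one_le_pow₀ (by norm_num)).trans hj.le
    have h1 : ((2 : ℝ) ^ i) ^ 2 ≤ x ^ p :=
      (pow_le_pow_left₀ (by positivity) hj.le 2).trans (pow_le_pow_right₀ hx1 hp)
    have h2 : 1 / x ^ p ≤ 1 / ((2 : ℝ) ^ i) ^ 2 := by gcongr
    refine h2.trans ?_
    have h3 : 1 / ((2 : ℝ) ^ i) ^ 2 = 4 * (1 / 4) ^ (i + 1) := by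
      rw [← pow_mul, mul_comm i 2, pow_mul, one_div_pow, pow_succ]
      norm_num
      field_simp
      ring
    rw [h3]
    gcongr
    have : 0 < 1 / δ ^ p := by positivity
    linarith

/-! ### Power sums over the zeros of an entire function -/

lemma Differentiable.exists_le_norm_of_eq_zero {f : ℂ → ℂ} (hf : Differentiable ℂ f)
    (h0 : f 0 ≠ 0) : ∃ δ : ℝ, 0 < δ ∧ ∀ a, f a = 0 → δ ≤ ‖a‖ := by
  obtain ⟨δ, hδ, h⟩ := Metric.eventually_nhds_iff.1 (hf.continuous.continuousAt.eventually_ne h0)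
  refine ⟨δ, hδ, fun a ha ↦ ?_⟩
  by_contra! hlt
  exact h (by simpa using hlt) ha

lemma Differentiable.finite_zeros_norm_le {f : ℂ → ℂ} (hf : Differentiable ℂ f) (h0 : f 0 ≠ 0)
    (R : ℝ) : {a : {a // f a = 0} | ‖(a : ℂ)‖ ≤ R}.Finite := by
  have han : AnalyticOnNhd ℂ f univ := fun z _ ↦ hf.analyticAt z
  have h := mem_codiscrete'.1 (han.preimage_zero_mem_codiscrete h0)
  have hcl : IsClosed (f ⁻¹' {0}) := isClosed_singleton.preimage hf.continuous
  have hd : IsDiscrete (f ⁻¹' {0}) := by simpa using h.2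
  have hfin : (Metric.closedBall 0 R ∩ f ⁻¹' {0}).Finite :=
    ((isCompact_closedBall 0 R).inter_right hcl).finite (hd.mono inter_subset_right)
  refine (hfin.preimage (f := fun a : {a // f a = 0} ↦ (a : ℂ))
    Subtype.val_injective.injOn).subset fun a ha ↦ ?_
  exact ⟨by simpa using ha, a.2⟩

theorem summable_order_div_norm_pow {f : ℂ → ℂ} (hf : Differentiable ℂ f) (h0 : f 0 ≠ 0) {C : ℝ}
    (hC : ∀ R : ℝ, 1 ≤ R → ∀ z, ‖z‖ ≤ R → ‖f z‖ ≤ Real.exp (C * (R * √R))) {p : ℕ} (hp : 2 ≤ p) :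
    Summable fun a : {a // f a = 0} ↦ (analyticOrderNatAt f a : ℝ) * (1 / ‖(a : ℂ)‖ ^ p) := by
  classical
  obtain ⟨K, hK, hN⟩ := exists_sum_order_le hf h0 hC
  obtain ⟨δ, hδ, hδa⟩ := hf.exists_le_norm_of_eq_zero h0
  have hex (a : {a // f a = 0}) : ∃ j : ℕ, ‖(a : ℂ)‖ ≤ 2 ^ j :=
    (pow_unbounded_of_one_lt _ one_lt_two).imp fun _ h ↦ h.le
  let j (a : {a // f a = 0}) : ℕ := Nat.find (hex a)
  have hj1 (a : {a // f a = 0}) : ‖(a : ℂ)‖ ≤ 2 ^ j a := Nat.find_spec (hex a)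
  have hj2 (a : {a // f a = 0}) : j a = 0 ∨ (2 : ℝ) ^ (j a - 1) < ‖(a : ℂ)‖ := by
    rcases Nat.eq_zero_or_pos (j a) with h | h
    · exact Or.inl h
    · exact Or.inr (not_le.1 (Nat.find_min (hex a) (Nat.sub_lt h one_pos)))
  set D : ℝ := 4 + 1 / δ ^ p
  have hD : 0 < D := by positivity
  have hr0 : 0 ≤ √2 / 2 := by positivity
  have hr1 : √2 / 2 < 1 := by
    rw [div_lt_one two_pos]
    exact (Real.sqrt_lt' two_pos).2 (by norm_num)
  -- A block of zeros with `2 ^ (i - 1) < ‖a‖ ≤ 2 ^ i` contributes `O(2 ^ (3i/2) / 4 ^ i)`, and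
  -- `2 ^ (3/2) / 4 = √2 / 2`.
  have hgeom := (summable_geometric_of_lt_one hr0 hr1).mul_left (D * K)
  refine summable_of_sum_le (c := ∑' i : ℕ, D * K * (√2 / 2) ^ i)
    (fun a ↦ by positivity) fun T ↦ ?_
  rw [← Finset.sum_fiberwise_of_maps_to (t := T.image j) (g := j)
    (fun a ha ↦ Finset.mem_image_of_mem j ha)]
  refine (Finset.sum_le_sum fun i _ ↦ ?_).trans
    (hgeom.sum_le_tsum (T.image j) fun i _ ↦ by positivity)
  have hNi := hN (2 ^ i) (one_le_pow₀ (by norm_num))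
    ((T.filter fun a ↦ j a = i).map (Function.Embedding.subtype _)) (by simp [h0]) (by
      intro a ha
      obtain ⟨b, hb, rfl⟩ := Finset.mem_map.1 ha
      rw [← (Finset.mem_filter.1 hb).2]
      exact hj1 b)
  rw [Finset.sum_map] at hNi
  push_cast at hNi
  have hsq : √((2 : ℝ) ^ i) = √2 ^ i := by
    rw [Real.sqrt_eq_iff_eq_sq (by positivity) (by positivity), ← pow_mul, mul_comm i 2, pow_mul,
      Real.sq_sqrt two_pos.le]
  calc ∑ a ∈ T with j a = i, (analyticOrderNatAt f a : ℝ) * (1 / ‖(a : ℂ)‖ ^ p)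
      ≤ ∑ a ∈ T with j a = i, (analyticOrderNatAt f a : ℝ) * (D * (1 / 4) ^ i) := by
        refine Finset.sum_le_sum fun a ha ↦ ?_
        gcongr
        rw [← (Finset.mem_filter.1 ha).2]
        exact one_div_pow_le_of_two_pow_lt (j a) (hj2 a) hp δ hδ (hδa a a.2)
    _ = (∑ a ∈ T with j a = i, (analyticOrderNatAt f a : ℝ)) * (D * (1 / 4) ^ i) := by
        rw [Finset.sum_mul]
    _ ≤ K * (2 ^ i * √(2 ^ i)) * (D * (1 / 4) ^ i) := by gcongr; exact hNi
    _ = D * K * (√2 / 2) ^ i := by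
        rw [hsq, show (1 / 4 : ℝ) = 1 / 2 * (1 / 2) by norm_num, mul_pow, one_div_pow, div_pow]
        field_simp

/-- A function without zeros on a disc has a logarithm there, whose derivatives at the centre are
controlled by an upper bound for its real part alone. -/
lemma norm_iteratedDeriv_logDeriv_le {g : ℂ → ℂ} (hg : Differentiable ℂ g) {R M : ℝ}
    (hR : 0 < R) (hM : 0 < M) (hne : ∀ z ∈ Metric.ball (0 : ℂ) R, g z ≠ 0)
    (hB : ∀ z ∈ Metric.ball (0 : ℂ) R, ‖g z‖ ≤ ‖g 0‖ * Real.exp M) (k : ℕ) :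
    ‖iteratedDeriv k (logDeriv g) 0‖ ≤ (k + 1).factorial * (2 * M) / (R / 2) ^ (k + 1) := by
  have h0 : (0 : ℂ) ∈ Metric.ball (0 : ℂ) R := Metric.mem_ball_self hR
  have hlog : DifferentiableOn ℂ (logDeriv g) (Metric.ball 0 R) := fun z hz ↦
    ((hg.deriv z).div (hg z) (hne z hz)).differentiableWithinAt
  obtain ⟨h, hh0, hh⟩ := hlog.isExactOn_ball.with_val_at 0 0
  have hhd : DifferentiableOn ℂ h (Metric.ball 0 R) := fun z hz ↦
    (hh z hz).differentiableAt.differentiableWithinAt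
  have hconst : ∀ z ∈ Metric.ball (0 : ℂ) R, g z * exp (-h z) = g 0 := by
    intro z hz
    have hder (w) (hw : w ∈ Metric.ball (0 : ℂ) R) :
        HasDerivAt (fun w ↦ g w * exp (-h w)) 0 w := by
      refine ((hg w).hasDerivAt.mul (hh w hw).neg.cexp).congr_deriv ?_
      have := hne w hw
      rw [logDeriv_apply]
      field_simp
      ring
    have := Metric.isOpen_ball.is_const_of_deriv_eq_zero (convex_ball 0 R).isPreconnected
      (fun w hw ↦ (hder w hw).differentiableAt.differentiableWithinAt)
      (fun w hw ↦ (hder w hw).deriv) hz h0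
    simpa [hh0] using this
  have hre : MapsTo h (Metric.ball 0 R) {z | z.re ≤ M} := by
    intro z hz
    have h1 := congrArg norm (hconst z hz)
    rw [norm_mul, norm_exp, neg_re, Real.exp_neg] at h1
    have h2 := hB z hz
    have hg0 : 0 < ‖g 0‖ := norm_pos_iff.2 (hne 0 h0)
    have h3 : ‖g z‖ = ‖g 0‖ * Real.exp (h z).re := by
      rw [← h1]; field_simp
    rw [h3] at h2
    exact Real.exp_le_exp.1 (le_of_mul_le_mul_left h2 hg0)
  have hbound : ∀ z ∈ Metric.sphere (0 : ℂ) (R / 2), ‖h z‖ ≤ 2 * M := by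
    intro z hz
    rw [mem_sphere_zero_iff_norm] at hz
    have := borelCaratheodory_zero hM hhd hre hR (z := z) (by simp [hz, hR]) hh0
    refine this.trans (le_of_eq ?_)
    rw [hz]
    field_simp
    ring
  have hderiv : logDeriv g =ᶠ[𝓝 0] deriv h := by
    filter_upwards [Metric.isOpen_ball.mem_nhds h0] with z hz
    exact (hh z hz).deriv.symm
  rw [hderiv.iteratedDeriv_eq, ← iteratedDeriv_succ']
  refine norm_iteratedDeriv_le_of_forall_mem_sphere_norm_le _ (by positivity) ?_ hbound
  refine DifferentiableOn.diffContOnCl (hhd.mono ?_)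
  rw [closure_ball _ (by positivity)]
  exact Metric.closedBall_subset_ball (by linarith)

lemma iteratedDeriv_logDeriv_one_sub_div {a : ℂ} (ha : a ≠ 0) (m k : ℕ) :
    iteratedDeriv k (logDeriv fun z : ℂ ↦ (1 - z / a) ^ m) 0 =
      -(k.factorial : ℂ) * (m * (1 / a ^ (k + 1))) := by
  have h : (logDeriv fun z : ℂ ↦ (1 - z / a) ^ m) = fun z ↦ (m : ℂ) * (1 * z - a)⁻¹ := by
    ext z
    rw [logDeriv_fun_pow (by fun_prop), logDeriv_apply, deriv_const_sub, deriv_div_const,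
      deriv_id'']
    congr 1
    rcases eq_or_ne z a with rfl | hza
    · simp [ha]
    · have h1 : z - a ≠ 0 := sub_ne_zero.2 hza
      have h2 : a - z ≠ 0 := sub_ne_zero.2 hza.symm
      have h3 : 1 - z / a ≠ 0 := by
        rw [one_sub_div ha]; exact div_ne_zero h2 ha
      rw [one_mul, one_sub_div ha]
      field_simp
      ring
  rw [h, iteratedDeriv_const_mul_field, iteratedDeriv_eq_iterate, iter_deriv_inv_linear_sub]
  have hz : (1 * 0 - a) ^ (-1 - k : ℤ) = (-1) ^ (k + 1) * (a ^ (k + 1))⁻¹ := by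
    rw [mul_zero, zero_sub, show (-1 - k : ℤ) = -((k + 1 : ℕ) : ℤ) by push_cast; ring, zpow_neg,
      zpow_natCast, neg_pow a, mul_inv, ← inv_pow]
    norm_num
  simp only [hz, one_pow, mul_one]
  have : ((-1 : ℂ) ^ k) * (-1) ^ (k + 1) = -1 := by
    rw [pow_succ, ← mul_assoc, ← mul_pow]; norm_num
  linear_combination (m : ℂ) * k.factorial * (a ^ (k + 1))⁻¹ * this

/-- The quotient `g` carries the contribution of the zeros outside `S`. -/
lemma iteratedDeriv_logDeriv_zeroProduct_mul {f g : ℂ → ℂ} {S : Finset ℂ}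
    (hg : Differentiable ℂ g) (hg0 : g 0 ≠ 0) (hS : 0 ∉ S)
    (hfg : ∀ z, f z = zeroProduct f S z * g z) (k : ℕ) :
    iteratedDeriv k (logDeriv f) 0 =
      -(k.factorial : ℂ) * ∑ a ∈ S, (analyticOrderNatAt f a : ℂ) * (1 / a ^ (k + 1)) +
      iteratedDeriv k (logDeriv g) 0 := by
  have hfac (a) (ha : a ∈ S) : (1 - (0 : ℂ) / a) ^ analyticOrderNatAt f a ≠ 0 := by simp
  have hP : Differentiable ℂ (zeroProduct f S) := differentiable_zeroProduct f S
  have hev : logDeriv f =ᶠ[𝓝 0] fun z ↦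
      (∑ a ∈ S, logDeriv (fun z : ℂ ↦ (1 - z / a) ^ analyticOrderNatAt f a) z) + logDeriv g z := by
    have hSo : ∀ᶠ z in 𝓝 (0 : ℂ), z ∉ S :=
      (S.finite_toSet.isClosed.isOpen_compl).mem_nhds hS
    filter_upwards [hSo, hg.continuous.continuousAt.eventually_ne hg0] with z hz hgz
    have hPz := zeroProduct_ne_zero f hS hz
    calc logDeriv f z = logDeriv (fun z ↦ zeroProduct f S z * g z) z := by rw [← funext hfg]
      _ = logDeriv (zeroProduct f S) z + logDeriv g z := logDeriv_mul z hPz hgz (hP z) (hg z)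
      _ = _ := by
        congr 1
        exact logDeriv_prod (fun a ha ↦ Finset.prod_ne_zero_iff.1 hPz a ha)
          (fun a _ ↦ by fun_prop)
  have hcd {u : ℂ → ℂ} (hu : Differentiable ℂ u) (hu0 : u 0 ≠ 0) :
      ContDiffAt ℂ k (logDeriv u) 0 :=
    ((hu.deriv.analyticAt 0).div (hu.analyticAt 0) hu0).contDiffAt
  rw [hev.iteratedDeriv_eq, iteratedDeriv_fun_add, iteratedDeriv_fun_sum, Finset.mul_sum]
  · congr 1
    refine Finset.sum_congr rfl fun a ha ↦ ?_
    exact iteratedDeriv_logDeriv_one_sub_div (fun h ↦ hS (h ▸ ha)) _ _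
  · exact fun a ha ↦ hcd (by fun_prop) (hfac a ha)
  · exact ContDiffAt.sum fun a ha ↦ hcd (by fun_prop) (hfac a ha)
  · exact hcd hg hg0

/-- The derivatives of `f'/f` at `0` are power sums over the zeros of `f`, as if the logarithmic
derivative of the Hadamard product of `f` were differentiated term by term. -/
theorem hasSum_iteratedDeriv_logDeriv {f : ℂ → ℂ} (hf : Differentiable ℂ f) (h0 : f 0 ≠ 0) {C : ℝ}
    (hC : ∀ R : ℝ, 1 ≤ R → ∀ z, ‖z‖ ≤ R → ‖f z‖ ≤ Real.exp (C * (R * √R))) {k : ℕ} (hk : 1 ≤ k) :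
    HasSum (fun a : {a // f a = 0} ↦
        (analyticOrderNatAt f a : ℂ) * (1 / (a : ℂ) ^ (k + 1)))
      (-(1 / (k.factorial : ℂ)) * iteratedDeriv k (logDeriv f) 0) := by
  set F : {a // f a = 0} → ℂ := fun a ↦ (analyticOrderNatAt f a : ℂ) * (1 / (a : ℂ) ^ (k + 1))
  set L := iteratedDeriv k (logDeriv f) 0
  have hk0 : (k.factorial : ℂ) ≠ 0 := by exact_mod_cast k.factorial_ne_zero
  have hsum : Summable F := by
    refine Summable.of_norm ((summable_order_div_norm_pow hf h0 hC (p := k + 1) (by omega)).congr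
      fun a ↦ ?_)
    simp [F]
  -- The zeros in the disc of radius `n`; along these finite sets the sum converges to `-L / k!`.
  let S (n : ℕ) : Finset {a // f a = 0} := (hf.finite_zeros_norm_le h0 n).toFinset
  have hS : Tendsto S atTop atTop := by
    refine tendsto_atTop_finset_of_monotone (fun m n hmn a ha ↦ ?_) fun a ↦ ?_
    · simp only [S, Set.Finite.mem_toFinset, mem_ofPred_eq] at ha ⊢
      exact ha.trans (by exact_mod_cast hmn)
    · obtain ⟨n, hn⟩ := exists_nat_ge ‖(a : ℂ)‖
      exact ⟨n, by simpa [S] using hn⟩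
  set c := |C| * (3 * √3) + |Real.log ‖f 0‖| with hc
  have hest : ∀ n : ℕ, 1 ≤ n → ‖-(k.factorial : ℂ) * ∑ a ∈ S n, F a - L‖ ≤
      (k + 1).factorial * (2 * (c + 1)) * 2 ^ (k + 1) / √n := by
    intro n hn
    have hn1 : (1 : ℝ) ≤ n := by exact_mod_cast hn
    have hn0 : (0 : ℝ) < n := by linarith
    let T : Finset ℂ := (S n).map (Function.Embedding.subtype _)
    have hT0 : 0 ∉ T := by simp [T, h0]
    have hmemT {z : ℂ} (hz : f z = 0) (hzn : ‖z‖ ≤ n) : z ∈ T := by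
      simp only [T, S, Finset.mem_map]
      exact ⟨⟨z, hz⟩, by simpa using hzn, rfl⟩
    obtain ⟨g, hg, hgT, hfg⟩ := hf.exists_eq_zeroProduct_mul h0 T hT0
    have hfg0 : f 0 = g 0 := by simpa using hfg 0
    have hg0 : g 0 ≠ 0 := hfg0 ▸ h0
    have hTn : ∀ a ∈ T, ‖a‖ ≤ n := by
      intro a ha
      obtain ⟨b, hb, rfl⟩ := Finset.mem_map.1 ha
      simpa [S] using hb
    have hrr : 1 ≤ (n : ℝ) * √n := by nlinarith [Real.one_le_sqrt.2 hn1]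
    have hgB : ∀ z ∈ Metric.ball (0 : ℂ) n, ‖g z‖ ≤ ‖g 0‖ * Real.exp ((c + 1) * (n * √n)) := by
      intro z hz
      rw [mem_ball_zero_iff] at hz
      have h1 := norm_mul_two_pow_sum_order_le hn0 hg hfg hT0 hTn
        (hC (3 * n) (by linarith)) (z := z) (by linarith)
      have h2 : ‖g z‖ ≤ Real.exp (C * (3 * n * √(3 * n))) :=
        (le_mul_of_one_le_right (norm_nonneg _) (one_le_pow₀ (by norm_num))).trans h1
      refine h2.trans ?_
      have hexp : ‖g 0‖ * Real.exp ((c + 1) * (n * √n)) =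
          Real.exp (Real.log ‖f 0‖ + (c + 1) * (n * √n)) := by
        rw [Real.exp_add, Real.exp_log (norm_pos_iff.2 h0), hfg0]
      rw [hexp]
      refine Real.exp_le_exp.2 ?_
      have e1 : C * (3 * n * √(3 * n)) = C * (3 * √3) * (n * √n) := by
        rw [Real.sqrt_mul (by norm_num)]; ring
      have e2 : C * (3 * √3) * (n * √n) ≤ |C| * (3 * √3) * (n * √n) := by
        gcongr; exact le_abs_self C
      have e3 : -Real.log ‖f 0‖ ≤ |Real.log ‖f 0‖| * (n * √n) :=
        (neg_le_abs _).trans (le_mul_of_one_le_right (abs_nonneg _) hrr)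
      rw [e1, hc]
      linarith
    have hgne : ∀ z ∈ Metric.ball (0 : ℂ) n, g z ≠ 0 := by
      intro z hz hgz
      rw [mem_ball_zero_iff] at hz
      exact hgT z (hmemT (by rw [hfg, hgz, mul_zero]) hz.le) hgz
    have hmain := norm_iteratedDeriv_logDeriv_le hg hn0
      (M := (c + 1) * (n * √n)) (by positivity) hgne hgB k
    have hL := iteratedDeriv_logDeriv_zeroProduct_mul hg hg0 hT0 hfg k
    have hTS : ∑ a ∈ T, (analyticOrderNatAt f a : ℂ) * (1 / a ^ (k + 1)) = ∑ a ∈ S n, F a := by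
      simp [T, F, Finset.sum_map]
    rw [hTS] at hL
    change L = _ at hL
    rw [hL, sub_add_cancel_left, norm_neg]
    refine hmain.trans ?_
    have hpow : (n : ℝ) ^ 2 ≤ n ^ (k + 1) := pow_le_pow_right₀ hn1 (by omega)
    have hsq : √(n : ℝ) * √n = n := Real.mul_self_sqrt hn0.le
    have hsqpos : 0 < √(n : ℝ) := Real.sqrt_pos.2 hn0
    rw [div_pow, div_div_eq_mul_div, div_le_div_iff₀ (by positivity) hsqpos]
    calc _ = (k + 1).factorial * (2 * (c + 1)) * 2 ^ (k + 1) * (n * (√(n : ℝ) * √n)) := by ring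
      _ = (k + 1).factorial * (2 * (c + 1)) * 2 ^ (k + 1) * n ^ 2 := by rw [hsq]; ring
      _ ≤ _ := by gcongr
  have hlim : Tendsto (fun n ↦ -(k.factorial : ℂ) * ∑ a ∈ S n, F a) atTop (𝓝 L) := by
    rw [tendsto_iff_norm_sub_tendsto_zero]
    have hz : Tendsto (fun n : ℕ ↦ (k + 1).factorial * (2 * (c + 1)) * 2 ^ (k + 1) / √(n : ℝ))
        atTop (𝓝 0) :=
      tendsto_const_nhds.div_atTop
        (Real.tendsto_sqrt_atTop.comp tendsto_natCast_atTop_atTop)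
    refine squeeze_zero' (Eventually.of_forall fun _ ↦ norm_nonneg _) ?_ hz
    filter_upwards [eventually_ge_atTop 1] with n hn using hest n hn
  have huniq := tendsto_nhds_unique hlim ((hsum.hasSum.comp hS).const_mul _)
  rw [huniq]
  convert hsum.hasSum using 1
  field_simp

/-! ### Zeros of zeta and zeros of xi -/

lemma riemannZeta_eq_mul_riemannXi {s : ℂ} (h0 : s ≠ 0) (h1 : s ≠ 1) :
    riemannZeta s = 2 / (s * (s - 1)) * (Gammaℝ s)⁻¹ * riemannXi s := by
  have h1' : s - 1 ≠ 0 := sub_ne_zero.2 h1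
  have h1'' : 1 - s ≠ 0 := sub_ne_zero.2 h1.symm
  have key : completedRiemannZeta s = 2 / (s * (s - 1)) * riemannXi s := by
    rw [completedRiemannZeta_eq, riemannXi]
    field_simp
    ring
  rw [riemannZeta_def_of_ne_zero h0, key]
  ring

lemma ne_zero_and_ne_one_of_riemannXi_eq_zero {s : ℂ} (h : riemannXi s = 0) : s ≠ 0 ∧ s ≠ 1 := by
  constructor <;> rintro rfl <;> simp [riemannXi] at h

lemma mem_zetaNontrivialZeros_iff {s : ℂ} : s ∈ zetaNontrivialZeros ↔ riemannXi s = 0 := by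
  constructor
  · rintro ⟨hz, h0, h1⟩
    have hs0 : s ≠ 0 := by rintro rfl; simp at h0
    have hs1 : s ≠ 1 := by rintro rfl; simp at h1
    have hG := Gammaℝ_ne_zero_of_re_pos h0
    have hs1' : s - 1 ≠ 0 := sub_ne_zero.2 hs1
    rw [riemannZeta_eq_mul_riemannXi hs0 hs1] at hz
    refine (mul_eq_zero.1 hz).resolve_left ?_
    exact mul_ne_zero (div_ne_zero two_ne_zero (mul_ne_zero hs0 hs1')) (inv_ne_zero hG)
  · have key {s : ℂ} (h : riemannXi s = 0) : riemannZeta s = 0 ∧ s.re < 1 := by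
      obtain ⟨hs0, hs1⟩ := ne_zero_and_ne_one_of_riemannXi_eq_zero h
      have hz : riemannZeta s = 0 := by rw [riemannZeta_eq_mul_riemannXi hs0 hs1, h, mul_zero]
      exact ⟨hz, not_le.1 fun hle ↦ riemannZeta_ne_zero_of_one_le_re hle hz⟩
    intro h
    have h2 := (key (s := 1 - s) (by rwa [riemannXi_one_sub])).2
    rw [sub_re, one_re] at h2
    exact ⟨(key h).1, by linarith, (key h).2⟩

lemma analyticOrderAt_riemannZeta {s : ℂ} (hs : s ∈ zetaNontrivialZeros) :
    analyticOrderAt riemannZeta s = analyticOrderAt riemannXi s := by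
  obtain ⟨-, h0, h1⟩ := hs
  have hs0 : s ≠ 0 := by rintro rfl; simp at h0
  have hs1 : s ≠ 1 := by rintro rfl; simp at h1
  have hs1' : s - 1 ≠ 0 := sub_ne_zero.2 hs1
  have hu : AnalyticAt ℂ (fun s ↦ 2 / (s * (s - 1)) * (Gammaℝ s)⁻¹) s := by
    have := differentiable_Gammaℝ_inv.analyticAt s
    refine AnalyticAt.mul (AnalyticAt.div (by fun_prop) (by fun_prop) (mul_ne_zero hs0 hs1')) this
  have hu0 : 2 / (s * (s - 1)) * (Gammaℝ s)⁻¹ ≠ 0 :=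
    mul_ne_zero (div_ne_zero two_ne_zero (mul_ne_zero hs0 hs1'))
      (inv_ne_zero (Gammaℝ_ne_zero_of_re_pos h0))
  have hev : riemannZeta =ᶠ[𝓝 s] (fun s ↦ 2 / (s * (s - 1)) * (Gammaℝ s)⁻¹) * riemannXi := by
    filter_upwards [isOpen_ne.mem_nhds hs0, isOpen_ne.mem_nhds hs1] with z hz0 hz1
    exact riemannZeta_eq_mul_riemannXi hz0 hz1
  rw [analyticOrderAt_congr hev, analyticOrderAt_mul hu (differentiable_riemannXi.analyticAt s),
    hu.analyticOrderAt_eq_zero.2 hu0, zero_add]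

/-- The xi function centred at its point of symmetry: `z ↦ ξ (1/2 + z)`. -/
noncomputable def shiftedXi (z : ℂ) : ℂ := riemannXi (1 / 2 + z)

lemma differentiable_shiftedXi : Differentiable ℂ shiftedXi :=
  differentiable_riemannXi.comp (by fun_prop)

lemma shiftedXi_zero_ne_zero : shiftedXi 0 ≠ 0 := by
  simpa [shiftedXi] using riemannXi_one_half_ne_zero

lemma analyticOrderNatAt_shiftedXi {s : ℂ} (hs : s ∈ zetaNontrivialZeros) :
    analyticOrderNatAt shiftedXi (s - 1 / 2) = analyticOrderNatAt riemannZeta s := by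
  have h : analyticOrderAt shiftedXi (s - 1 / 2) = analyticOrderAt riemannXi s := by
    have := analyticOrderAt_comp_of_deriv_ne_zero (f := riemannXi)
      (g := fun z : ℂ ↦ 1 / 2 + z) (z₀ := s - 1 / 2) (by fun_prop) (by simp)
    rw [show 1 / 2 + (s - 1 / 2) = s by ring] at this
    exact this
  rw [analyticOrderNatAt, h, analyticOrderNatAt, analyticOrderAt_riemannZeta hs]

lemma analyticOrderNatAt_riemannZeta_pos {s : ℂ} (hs : s ∈ zetaNontrivialZeros) :
    0 < analyticOrderNatAt riemannZeta s := by
  have h1 := differentiable_shiftedXi.analyticOrderAt_ne_top shiftedXi_zero_ne_zero (s - 1 / 2)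
  have h2 : analyticOrderAt shiftedXi (s - 1 / 2) ≠ 0 := by
    rw [(differentiable_shiftedXi.analyticAt _).analyticOrderAt_ne_zero, shiftedXi]
    simpa using mem_zetaNontrivialZeros_iff.1 hs
  rw [← analyticOrderNatAt_shiftedXi hs, pos_iff_ne_zero]
  intro h
  apply h2
  rw [← Nat.cast_analyticOrderNatAt h1, h, Nat.cast_zero]

/-- The translation `ρ ↦ ρ - 1/2` from the nontrivial zeros of `ζ` to the zeros of
`z ↦ ξ (1/2 + z)`. -/
noncomputable def zetaNontrivialZerosEquiv : zetaNontrivialZeros ≃ {a // shiftedXi a = 0} :=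
  (Equiv.subRight (1 / 2 : ℂ)).subtypeEquiv fun s ↦ by
    simp [shiftedXi, mem_zetaNontrivialZeros_iff]

lemma norm_shiftedXi_le : ∀ R : ℝ, 1 ≤ R → ∀ z, ‖z‖ ≤ R →
    ‖shiftedXi z‖ ≤ Real.exp (16 * (R * √R)) := fun _ hR _ hz ↦ norm_riemannXi_le hR hz

lemma summable_zetaZeroTerm {k : ℕ} (hk : 1 ≤ k) : Summable (zetaZeroTerm k) := by
  have h := summable_order_div_norm_pow differentiable_shiftedXi shiftedXi_zero_ne_zero
    norm_shiftedXi_le (p := k + 1) (by omega)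
  refine (zetaNontrivialZerosEquiv.summable_iff.2 h).congr fun ρ ↦ ?_
  change (analyticOrderNatAt shiftedXi ((ρ : ℂ) - 1 / 2) : ℝ) *
    (1 / ‖(ρ : ℂ) - 1 / 2‖ ^ (k + 1)) = _
  rw [analyticOrderNatAt_shiftedXi ρ.2, norm_sub_rev, zetaZeroTerm]

/-- Multiplication by `I` absorbs the sign `(-1) ^ ((k + 1) / 2) = I ^ (k + 1)`. -/
lemma hasSum_zetaNontrivialZeros {k : ℕ} (hk : Odd k) :
    HasSum (fun ρ : zetaNontrivialZeros ↦
        (analyticOrderNatAt riemannZeta ρ : ℂ) * (1 / (I * ((ρ : ℂ) - 1 / 2)) ^ (k + 1)))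
      ((-1 : ℂ) ^ ((k - 1) / 2) / (k.factorial : ℂ) *
          iteratedDeriv k (fun s : ℂ => deriv riemannXi s / riemannXi s) (1 / 2)) := by
  have h := hasSum_iteratedDeriv_logDeriv differentiable_shiftedXi shiftedXi_zero_ne_zero
    norm_shiftedXi_le hk.pos
  have h' := (zetaNontrivialZerosEquiv.hasSum_iff.2 h).mul_left (1 / I ^ (k + 1))
  have hD : iteratedDeriv k (logDeriv shiftedXi) 0 =
      iteratedDeriv k (fun s : ℂ => deriv riemannXi s / riemannXi s) (1 / 2) := by
    have h1 : logDeriv shiftedXi =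
        fun z ↦ (fun s ↦ deriv riemannXi s / riemannXi s) (1 / 2 + z) := by
      ext z
      rw [logDeriv_apply]
      change deriv (fun z ↦ riemannXi (1 / 2 + z)) z / _ = _
      rw [deriv_comp_const_add]
      rfl
    rw [h1, iteratedDeriv_comp_const_add k (fun s ↦ deriv riemannXi s / riemannXi s)]
    simp only [add_zero]
  have hI : 1 / I ^ (k + 1) * -1 = (-1) ^ ((k - 1) / 2) := by
    obtain ⟨m, rfl⟩ := hk
    rw [show (2 * m + 1 - 1) / 2 = m by omega, show 2 * m + 1 + 1 = 2 * (m + 1) by ring, pow_mul,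
      I_sq, one_div, ← inv_pow, pow_succ]
    norm_num
  rw [hD] at h'
  have hfun : (fun ρ : zetaNontrivialZeros ↦ (analyticOrderNatAt riemannZeta ρ : ℂ) *
      (1 / (I * ((ρ : ℂ) - 1 / 2)) ^ (k + 1))) = fun ρ : zetaNontrivialZeros ↦ 1 / I ^ (k + 1) *
      ((analyticOrderNatAt shiftedXi ((ρ : ℂ) - 1 / 2) : ℂ) *
        (1 / ((ρ : ℂ) - 1 / 2) ^ (k + 1))) := by
    ext ρ
    rw [analyticOrderNatAt_shiftedXi ρ.2, mul_pow]
    simp only [one_div, mul_inv]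
    rw [mul_left_comm]
  have hval : (-1 : ℂ) ^ ((k - 1) / 2) / (k.factorial : ℂ) *
      iteratedDeriv k (fun s : ℂ => deriv riemannXi s / riemannXi s) (1 / 2) =
      1 / I ^ (k + 1) * (-(1 / (k.factorial : ℂ)) *
        iteratedDeriv k (fun s : ℂ => deriv riemannXi s / riemannXi s) (1 / 2)) := by
    rw [← hI]
    ring
  rw [hfun, hval]
  exact h'

/-- If an even power `w ^ p` is positive and `w` is not real, then `w` makes an angle of at least
`2π / p` with the real axis. -/
lemma four_le_and_abs_re_mul_sin_le {w : ℂ} {p : ℕ} (hp : Even p) (hp0 : p ≠ 0)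
    (hw : w ^ p = ‖w‖ ^ p) (him : w.im ≠ 0) :
    4 ≤ p ∧ |w.re| * Real.sin (2 * Real.pi / p) ≤ |w.im| * Real.cos (2 * Real.pi / p) := by
  -- The reflections `w ↦ conj w` and `w ↦ -w` reduce to the first quadrant, `p` being even.
  wlog hpos : 0 ≤ w.re ∧ 0 < w.im generalizing w
  · rcases le_total 0 w.re with hre | hre <;> rcases lt_or_gt_of_ne him with hi | hi
    · have := this (w := (starRingEnd ℂ) w) (by rw [← map_pow, hw]; simp) (by simpa)
        ⟨by simpa, by simpa⟩
      simpa using this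
    · exact this hw him ⟨hre, hi⟩
    · have := this (w := -w) (by rw [hp.neg_pow, hw, norm_neg]) (by simpa)
        ⟨by simpa, by simpa⟩
      simpa using this
    · have := this (w := -(starRingEnd ℂ) w) (by rw [hp.neg_pow, ← map_pow, hw]; simp) (by simpa)
        ⟨by simpa, by simpa⟩
      simpa using this
  obtain ⟨hre, hi⟩ := hpos
  have hw0 : w ≠ 0 := by rintro rfl; simp at hi
  have hnorm : 0 < ‖w‖ := norm_pos_iff.2 hw0
  have hp' : (0 : ℝ) < p := by exact_mod_cast Nat.pos_of_ne_zero hp0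
  set θ := w.arg with hθ
  have hθ2 : θ ≤ Real.pi / 2 := (le_abs_self _).trans (abs_arg_le_pi_div_two_iff.2 hre)
  have hθ0 : 0 < θ := by
    refine lt_of_le_of_ne (arg_nonneg_iff.2 hi.le) fun h ↦ ?_
    have := (arg_eq_zero_iff.1 h.symm).2
    exact him this
  -- `p * θ` is a positive multiple of `2π`, while `0 < θ ≤ π / 2`.
  have hexp : exp (p * (θ * I)) = 1 := by
    have h1 := norm_mul_exp_arg_mul_I w
    rw [← h1, mul_pow, ← exp_nat_mul] at hw
    simp only [norm_mul, norm_real, norm_norm, norm_exp_ofReal_mul_I, mul_one] at hw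
    have : ((‖w‖ : ℂ) ^ p) ≠ 0 := pow_ne_zero _ (by exact_mod_cast hnorm.ne')
    exact mul_left_cancel₀ this (by rw [mul_one]; exact hw)
  obtain ⟨n, hn⟩ := exp_eq_one_iff.1 hexp
  have hn' : p * θ = n * (2 * Real.pi) := by
    have : ((p * θ : ℝ) : ℂ) * I = ((n * (2 * Real.pi) : ℝ) : ℂ) * I := by
      push_cast
      linear_combination hn
    exact_mod_cast mul_right_cancel₀ I_ne_zero this
  have hpi := Real.pi_pos
  have hn1 : (1 : ℝ) ≤ n := by
    have : (0 : ℝ) < n := by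
      by_contra! h
      nlinarith [mul_pos hp' hθ0]
    have : 0 < n := by exact_mod_cast this
    exact_mod_cast this
  have hpθ : 2 * Real.pi ≤ p * θ := by rw [hn']; nlinarith
  have hp4 : (4 : ℝ) ≤ p := by
    by_contra! h
    nlinarith
  refine ⟨by exact_mod_cast hp4, ?_⟩
  have hα : 2 * Real.pi / p ≤ θ := by rw [div_le_iff₀ hp']; linarith
  have hα0 : 0 < 2 * Real.pi / p := by positivity
  have hsin : 0 ≤ Real.sin (θ - 2 * Real.pi / p) :=
    Real.sin_nonneg_of_nonneg_of_le_pi (by linarith) (by linarith)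
  rw [Real.sin_sub] at hsin
  rw [abs_of_nonneg hre, abs_of_pos hi, ← norm_mul_cos_arg w, ← norm_mul_sin_arg w, ← hθ]
  nlinarith

/-! ### The criterion -/

theorem mainTheorem3 (k : ℕ) (hk : Odd k) :
    Summable (zetaZeroTerm k) ∧
    (RiemannHypothesis →
      (-1 : ℂ) ^ ((k - 1) / 2) / (k.factorial : ℂ) *
          iteratedDeriv k (fun s : ℂ => deriv riemannXi s / riemannXi s) (1 / 2) =
        ((∑' ρ : zetaNontrivialZeros, zetaZeroTerm k ρ : ℝ) : ℂ)) ∧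
    ((-1 : ℂ) ^ ((k - 1) / 2) / (k.factorial : ℂ) *
          iteratedDeriv k (fun s : ℂ => deriv riemannXi s / riemannXi s) (1 / 2) =
        ((∑' ρ : zetaNontrivialZeros, zetaZeroTerm k ρ : ℝ) : ℂ) →
      ∀ ρ ∈ zetaNontrivialZeros,
        (k = 1 ∨ 1 / 2 * Real.cot (2 * Real.pi / ((k : ℝ) + 1)) < |ρ.im|) → ρ.re = 1 / 2) := by
  have hsum := summable_zetaZeroTerm hk.pos
  have hD := hasSum_zetaNontrivialZeros hk
  have heven : Even (k + 1) := hk.add_one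
  have hterm (ρ : zetaNontrivialZeros) : zetaZeroTerm k ρ =
      (analyticOrderNatAt riemannZeta ρ : ℝ) * (1 / ‖I * ((ρ : ℂ) - 1 / 2)‖ ^ (k + 1)) := by
    rw [zetaZeroTerm, norm_mul, norm_I, one_mul, norm_sub_rev]
  refine ⟨hsum, fun hRH ↦ ?_, fun heq ρ hρ hcase ↦ ?_⟩
  · refine hD.unique ?_
    have hfun : (fun ρ : zetaNontrivialZeros ↦ (analyticOrderNatAt riemannZeta ρ : ℂ) *
        (1 / (I * ((ρ : ℂ) - 1 / 2)) ^ (k + 1))) = fun ρ ↦ ofRealCLM (zetaZeroTerm k ρ) := by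
      ext ρ
      obtain ⟨hz, h0, h1⟩ := ρ.2
      have hre : (ρ : ℂ).re = 1 / 2 := by
        refine hRH ρ hz ?_ ?_
        · rintro ⟨n, hn⟩
          rw [hn] at h0
          simp at h0
          linarith [(Nat.cast_nonneg n : (0 : ℝ) ≤ n)]
        · intro h
          rw [h] at h1
          simp at h1
      have hw : I * ((ρ : ℂ) - 1 / 2) = ((-(ρ : ℂ).im : ℝ) : ℂ) := by
        apply Complex.ext <;> simp [hre]
      rw [ofRealCLM_apply, hterm, hw, norm_real, Real.norm_eq_abs, heven.pow_abs]
      push_cast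
      rfl
    rw [hfun]
    exact ofRealCLM.hasSum hsum.hasSum
  · rw [heq] at hD
    have hre := reCLM.hasSum hD
    have hdiff := hsum.hasSum.sub hre
    simp only [reCLM_apply, ofReal_re, sub_self] at hdiff
    have hnonneg : ∀ ρ : zetaNontrivialZeros, 0 ≤ zetaZeroTerm k ρ -
        ((analyticOrderNatAt riemannZeta ρ : ℂ) *
          (1 / (I * ((ρ : ℂ) - 1 / 2)) ^ (k + 1))).re := by
      intro ρ
      rw [sub_nonneg, hterm]
      refine (re_le_norm _).trans (le_of_eq ?_)
      simp
    -- Nonnegative differences that sum to zero all vanish.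
    have hzero := congrFun ((hasSum_zero_iff_of_nonneg hnonneg).1 hdiff) ⟨ρ, hρ⟩
    set w := I * (ρ - 1 / 2) with hw
    have hm : (0 : ℝ) < analyticOrderNatAt riemannZeta ρ := by
      exact_mod_cast analyticOrderNatAt_riemannZeta_pos hρ
    have hwp : w ^ (k + 1) = ‖w‖ ^ (k + 1) := by
      simp only [hterm, Pi.zero_apply, ← hw, ← ofReal_natCast, re_ofReal_mul] at hzero
      have h1 : (1 / w ^ (k + 1)).re = ‖1 / w ^ (k + 1)‖ := by
        rw [norm_div, norm_one, norm_pow]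
        have : (analyticOrderNatAt riemannZeta ρ : ℝ) *
          (1 / ‖w‖ ^ (k + 1) - (1 / w ^ (k + 1)).re) = 0 := by linear_combination hzero
        linarith [(mul_eq_zero.1 this).resolve_left hm.ne']
      have h2 : 1 / w ^ (k + 1) = (‖1 / w ^ (k + 1)‖ : ℂ) := by
        have h3 := re_eq_norm.1 h1
        exact eq_coe_norm_of_nonneg h3
      rw [norm_div, norm_one, norm_pow] at h2
      push_cast at h2
      rw [one_div, one_div] at h2
      exact inv_injective h2
    have hwre : w.re = -ρ.im := by simp [hw]
    have hwim : w.im = ρ.re - 1 / 2 := by simp [hw]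
    by_contra hne
    have him : w.im ≠ 0 := by rw [hwim]; exact sub_ne_zero.2 hne
    obtain ⟨h4, hle⟩ := four_le_and_abs_re_mul_sin_le heven (by omega) hwp him
    rcases hcase with rfl | hcot
    · omega
    have hk4 : (4 : ℝ) ≤ (k : ℝ) + 1 := by exact_mod_cast h4
    push_cast at hle
    rw [hwre, abs_neg] at hle
    have hpi := Real.pi_pos
    set α := 2 * Real.pi / ((k : ℝ) + 1)
    have hα0 : 0 < α := by positivity
    have hα2 : α ≤ Real.pi / 2 := by
      rw [div_le_div_iff₀ (by positivity) two_pos]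
      nlinarith
    have hsin : 0 < Real.sin α := Real.sin_pos_of_pos_of_lt_pi hα0 (by linarith)
    have hcos : 0 ≤ Real.cos α := Real.cos_nonneg_of_mem_Icc ⟨by linarith, hα2⟩
    have himle : |w.im| ≤ 1 / 2 := by
      rw [hwim, abs_le]
      constructor <;> linarith [hρ.2.1, hρ.2.2]
    rw [Real.cot_eq_cos_div_sin, mul_div_assoc', div_lt_iff₀ hsin] at hcot
    nlinarith [mul_le_mul_of_nonneg_right himle hcos]
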